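/- Let $(M,h)$ and $(N,g)$ be smooth Riemannian manifolds without boundary, $m=\dim M>2$, and let $\phi\colon M\to N$ be a smooth map. Let $\delta_1,\delta_2\in\mathbb{R}$, not both zero. Denote by $\tau(\phi)=\operatorname{Tr}_h\nabla d\phi$ the tension field of $\phi$, a section of $\phi^*TN$, and by $\nabla$ the pullback to $\phi^*TN$ of the Levi-Civita connection of $N$. The energy-momentum tensor of the functional $\delta_1\int_M|d\phi|^2\,dV+\delta_2\int_M|\tau(\phi)|^2\,dV$ is $$T(X,Y)=\delta_1\Big(\langle d\phi(X),d\phi(Y)\rangle-\tfrac12|d\phi|^2h(X,Y)\Big)+\delta_2\Big(\tfrac12|\tau(\phi)|^2h(X,Y)+\langle d\phi,\nabla\tau(\phi)\rangle h(X,Y)-\langle d\phi(X),\nabla_Y\tau(\phi)\rangle-\langle d\phi(Y),\nabla_X\tau(\phi)\rangle\Big),$$ where $|d\phi|^2=\sum_\alpha|d\phi(e_\alpha)|^2$ and $\langle d\phi,\nabla\tau(\phi)\rangle=\sum_\alpha\langle d\phi(e_\alpha),\nabla_{e_\alpha}\tau(\phi)\rangle$ for an orthonormal basis $(e_\alpha)$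 of the tangent space of $M$. Suppose that $T(X,Y)=0$ for all $p\in M$ and $X,Y\in T_pM$, and that $\operatorname{rank} d\phi_p\le m-1$ for every $p\in M$. Then $\phi$ is harmonic, that is, $\tau(\phi)=0$ on $M$. -/

import Mathlib

open Bundle Manifold
open scoped ContDiff

noncomputable section

namespace SemiBiharmonic

/-- The model space `ℝ^m` with its Euclidean norm. -/
abbrev Model (m : ℕ) : Type := EuclideanSpace ℝ (Fin m)

/-- The `i`-th standard basis vector of `ℝ^m`. -/
def stdVec {m : ℕ} (i : Fin m) : Model m := EuclideanSpace.single i (1 : ℝ)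

section Charts

variable {m : ℕ} {M : Type*} [TopologicalSpace M] [ChartedSpace (Model m) M]

/-- Components, in the preferred chart around `a`, of a tangent vector `v ∈ T_x M`
(meaningful for `x` in the domain of that chart). -/
def coordVec (a x : M) : TangentSpace (𝓡 m) x →L[ℝ] Model m :=
  mfderiv (𝓡 m) 𝓘(ℝ, Model m) (extChartAt (𝓡 m) a) x

/-- The tangent vector in `T_x M` with prescribed components in the preferred chart around `a`
(meaningful for `x` in the domain of that chart, where `coordVec a x` is invertible). -/
def ofCoord (a x : M) : Model m →L[ℝ] TangentSpace (𝓡 m) x :=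
  (coordVec a x).inverse

/-- The coordinate vector field `∂_i` of the preferred chart around `a`, at the point `x`. -/
def coordField (a x : M) (i : Fin m) : TangentSpace (𝓡 m) x :=
  ofCoord a x (stdVec i)

variable [RiemannianBundle (fun x : M => TangentSpace (𝓡 m) x)]

/-- The Gram matrix `g_{ij} = ⟨∂_i, ∂_j⟩` of the metric in the preferred chart around `a`,
as a function of the coordinates `y`. -/
def metricMatrix (a : M) (y : Model m) : Matrix (Fin m) (Fin m) ℝ :=
  Matrix.of fun i j =>
    inner ℝ (coordField a ((extChartAt (𝓡 m) a).symm y) i)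
      (coordField a ((extChartAt (𝓡 m) a).symm y) j)

/-- The partial derivative `∂_l g_{ij}` in the preferred chart around `a`. -/
def dMetric (a : M) (y : Model m) (l i j : Fin m) : ℝ :=
  fderiv ℝ (fun z => metricMatrix a z i j) y (stdVec l)

/-- The Christoffel symbols
`Γ^k_{ij} = ½ ∑_l g^{kl} (∂_i g_{jl} + ∂_j g_{il} - ∂_l g_{ij})`
of the Levi-Civita connection in the preferred chart around `a`. -/
def christoffel (a : M) (y : Model m) (k i j : Fin m) : ℝ :=
  (1 / 2) * ∑ l, (metricMatrix a y)⁻¹ k l *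
    (dMetric a y i j l + dMetric a y j i l - dMetric a y l i j)

/-- `Γ(u, v) = ∑_{ijk} Γ^k_{ij} u^i v^j e_k` in the preferred chart around `a`. -/
def christoffelForm (a : M) (y u v : Model m) : Model m :=
  ∑ k, (∑ i, ∑ j, christoffel a y k i j * u i * v j) • stdVec k

end Charts

section Maps

variable (m n : ℕ) {M N : Type*}
  [TopologicalSpace M] [ChartedSpace (Model m) M]
  [TopologicalSpace N] [ChartedSpace (Model n) N]

/-- The differential `dφ_p : T_p M → T_{φ p} N`. -/
def differential (φ : M → N) (p : M) :
    TangentSpace (𝓡 m) p →L[ℝ] TangentSpace (𝓡 n) (φ p) :=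
  mfderiv (𝓡 m) (𝓡 n) φ p

variable [RiemannianBundle (fun x : N => TangentSpace (𝓡 n) x)]

/-- The Levi-Civita connection of `N` pulled back to `φ^* TN`: for a section `V` of `φ^* TN` and
`X ∈ T_p M`, the vector `∇_X V ∈ T_{φ p} N` whose components in the chart around `φ p` are
`X(V^i) + Γ^i_{jk} dφ(X)^j V^k`. -/
def covDerivAlong (φ : M → N) (V : (q : M) → TangentSpace (𝓡 n) (φ q)) (p : M)
    (X : TangentSpace (𝓡 m) p) : TangentSpace (𝓡 n) (φ p) :=
  ofCoord (φ p) (φ p)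
    (fderiv ℝ
        (fun y : Model m =>
          coordVec (φ p) (φ ((extChartAt (𝓡 m) p).symm y)) (V ((extChartAt (𝓡 m) p).symm y)))
        (extChartAt (𝓡 m) p p) (coordVec p p X)
      + christoffelForm (φ p) (extChartAt (𝓡 n) (φ p) (φ p))
          (coordVec (φ p) (φ p) (differential m n φ p X))
          (coordVec (φ p) (φ p) (V p)))

variable [RiemannianBundle (fun x : M => TangentSpace (𝓡 m) x)]

/-- The second fundamental form `∇dφ` at `p`: if `f` is the expression of `φ` in the charts
around `p` and `φ p`, then
`∇dφ(X, Y) = D²f(X, Y) - Df(Γ^M(X, Y)) + Γ^N(Df X, Df Y)` in these charts. -/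
def secondFundamentalForm (φ : M → N) (p : M) (X Y : TangentSpace (𝓡 m) p) :
    TangentSpace (𝓡 n) (φ p) :=
  let f : Model m → Model n := writtenInExtChartAt (𝓡 m) (𝓡 n) p φ
  let y : Model m := extChartAt (𝓡 m) p p
  let u : Model m := coordVec p p X
  let v : Model m := coordVec p p Y
  ofCoord (φ p) (φ p)
    (fderiv ℝ (fderiv ℝ f) y u v - fderiv ℝ f y (christoffelForm p y u v)
      + christoffelForm (φ p) (f y) (fderiv ℝ f y u) (fderiv ℝ f y v))

/-- An orthonormal basis of `T_p M`. -/
def frame (p : M) : OrthonormalBasis (Fin m) ℝ (TangentSpace (𝓡 m) p) :=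
  haveI : FiniteDimensional ℝ (TangentSpace (𝓡 m) p) :=
    inferInstanceAs (FiniteDimensional ℝ (Model m))
  (stdOrthonormalBasis ℝ (TangentSpace (𝓡 m) p)).reindex
    (finCongr (finrank_euclideanSpace_fin (𝕜 := ℝ) (n := m)))

/-- The tension field `τ(φ) = Tr ∇dφ`, a section of `φ^* TN`. -/
def tensionField (φ : M → N) (p : M) : TangentSpace (𝓡 n) (φ p) :=
  ∑ α, secondFundamentalForm m n φ p (frame m p α) (frame m p α)

/-- `φ` is harmonic if its tension field vanishes. -/
def IsHarmonic (φ : M → N) : Prop :=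
  ∀ p : M, tensionField m n φ p = 0

/-- `|dφ|² = ∑_α |dφ(e_α)|²`. -/
def normSqDifferential (φ : M → N) (p : M) : ℝ :=
  ∑ α, ‖differential m n φ p (frame m p α)‖ ^ 2

/-- `∇_X τ(φ)`. -/
def nablaTension (φ : M → N) (p : M) (X : TangentSpace (𝓡 m) p) : TangentSpace (𝓡 n) (φ p) :=
  covDerivAlong m n φ (tensionField m n φ) p X

/-- `⟨dφ, ∇τ(φ)⟩ = ∑_α ⟨dφ(e_α), ∇_{e_α} τ(φ)⟩`. -/
def innerDifferentialNablaTension (φ : M → N) (p : M) : ℝ :=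
  ∑ α, inner ℝ (differential m n φ p (frame m p α)) (nablaTension m n φ p (frame m p α))

/-- The energy-momentum tensor of the functional `δ₁ ∫ |dφ|² + δ₂ ∫ |τ(φ)|²`. -/
def energyMomentum (δ₁ δ₂ : ℝ) (φ : M → N) (p : M) (X Y : TangentSpace (𝓡 m) p) : ℝ :=
  δ₁ * (inner ℝ (differential m n φ p X) (differential m n φ p Y)
      - (1 / 2) * normSqDifferential m n φ p * inner ℝ X Y)
    + δ₂ * ((1 / 2) * ‖tensionField m n φ p‖ ^ 2 * inner ℝ X Y
      + innerDifferentialNablaTension m n φ p * inner ℝ X Y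
      - inner ℝ (differential m n φ p X) (nablaTension m n φ p Y)
      - inner ℝ (differential m n φ p Y) (nablaTension m n φ p X))

end Maps

end SemiBiharmonic

end

/-!
The argument is pointwise. Summing `T(e_α, e_α) = 0` over an orthonormal basis gives
`δ₁ (1 - m/2) |dφ|² + δ₂ (m/2 |τ|² + (m - 2) ⟨dφ, ∇τ⟩) = 0`. By the rank condition there is a unit
vector `X` in the kernel of `dφ_p`, and `T(X, X) = 0` reads
`- δ₁/2 |dφ|² + δ₂ (|τ|²/2 + ⟨dφ, ∇τ⟩) = 0`. Subtracting `m - 2` times the second identity from the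
first leaves `δ₂ |τ|² = 0`, which settles the case `δ₂ ≠ 0`. If `δ₂ = 0`, then `δ₁ ≠ 0`, and the
traced identity together with `m > 2` gives `dφ = 0` everywhere, so `τ(φ) = 0`.
-/

namespace SemiBiharmonic

section Charts

variable {m : ℕ} {M : Type*} [TopologicalSpace M] [ChartedSpace (Model m) M]
  [RiemannianBundle (fun x : M => TangentSpace (𝓡 m) x)]

@[simp]
theorem christoffelForm_zero_left (a : M) (y v : Model m) : christoffelForm a y 0 v = 0 := by
  simp [christoffelForm]

end Charts

section Maps

variable {m n : ℕ} {M N : Type*}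
  [TopologicalSpace M] [ChartedSpace (Model m) M]
  [TopologicalSpace N] [ChartedSpace (Model n) N]

/-- If `dφ = 0` everywhere, the chart expression of `φ` has zero derivative on a whole neighbourhood,
not only at the centre of the chart; its second derivative there therefore vanishes too. -/
theorem eventually_fderiv_writtenInExtChartAt_eq_zero
    [IsManifold (𝓡 m) ∞ M] [IsManifold (𝓡 n) ∞ N] {φ : M → N}
    (hφ : ContMDiff (𝓡 m) (𝓡 n) ∞ φ) (h : ∀ p, differential m n φ p = 0) (p : M) :
    ∀ᶠ z in nhds (extChartAt (𝓡 m) p p),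
      fderiv ℝ (writtenInExtChartAt (𝓡 m) (𝓡 n) p φ) z = 0 := by
  have : IsManifold (𝓡 m) 1 M := IsManifold.of_le (n := ∞) (by norm_cast)
  have : IsManifold (𝓡 n) 1 N := IsManifold.of_le (n := ∞) (by norm_cast)
  have hcont : ContinuousAt (fun z => φ ((extChartAt (𝓡 m) p).symm z))
      (extChartAt (𝓡 m) p p) :=
    ContinuousAt.comp (f := (extChartAt (𝓡 m) p).symm)
      hφ.continuous.continuousAt (continuousAt_extChartAt_symm p)
  have hsource : (chartAt (Model n) (φ p)).source ∈
      nhds (φ ((extChartAt (𝓡 m) p).symm (extChartAt (𝓡 m) p p))) := by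
    rw [extChartAt_to_inv]
    exact chart_source_mem_nhds _ _
  filter_upwards [extChartAt_target_mem_nhds (I := 𝓡 m) p, hcont hsource] with z hz hφz
  have h₁ : MDifferentiableAt 𝓘(ℝ, Model m) (𝓡 m) (extChartAt (𝓡 m) p).symm z :=
    (mdifferentiableWithinAt_extChartAt_symm hz).mdifferentiableAt (by simp)
  have h₂ : MDifferentiableAt (𝓡 m) (𝓡 n) φ ((extChartAt (𝓡 m) p).symm z) :=
    hφ.mdifferentiableAt (by simp)
  have h₃ : MDifferentiableAt (𝓡 n) 𝓘(ℝ, Model n) (extChartAt (𝓡 n) (φ p))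
      (φ ((extChartAt (𝓡 m) p).symm z)) := mdifferentiableAt_extChartAt hφz
  have h₂' : mfderiv (𝓡 m) (𝓡 n) φ ((extChartAt (𝓡 m) p).symm z) = 0 := h _
  have h₁₂₃ := mfderiv_comp z h₃ (h₂.comp z h₁)
  rw [mfderiv_comp z h₂ h₁, h₂', ContinuousLinearMap.zero_comp, ContinuousLinearMap.comp_zero,
    mfderiv_eq_fderiv] at h₁₂₃
  exact h₁₂₃

variable [RiemannianBundle (fun x : M => TangentSpace (𝓡 m) x)]

theorem differential_eq_zero_of_normSqDifferential_eq_zero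
    [RiemannianBundle (fun x : N => TangentSpace (𝓡 n) x)] {φ : M → N} {p : M}
    (h : normSqDifferential m n φ p = 0) : differential m n φ p = 0 := by
  have hα := (Finset.sum_eq_zero_iff_of_nonneg fun α _ => sq_nonneg _).1 h
  have : (differential m n φ p).toLinearMap = 0 :=
    (frame m p).toBasis.ext fun α => by simpa using hα α (Finset.mem_univ α)
  exact ContinuousLinearMap.coe_injective this

theorem isHarmonic_of_differential_eq_zero
    [RiemannianBundle (fun x : N => TangentSpace (𝓡 n) x)]
    [IsManifold (𝓡 m) ∞ M] [IsManifold (𝓡 n) ∞ N] {φ : M → N}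
    (hφ : ContMDiff (𝓡 m) (𝓡 n) ∞ φ) (h : ∀ p, differential m n φ p = 0) :
    IsHarmonic m n φ := by
  intro p
  have h₁ := eventually_fderiv_writtenInExtChartAt_eq_zero hφ h p
  have h₂ : fderiv ℝ (fderiv ℝ (writtenInExtChartAt (𝓡 m) (𝓡 n) p φ))
      (extChartAt (𝓡 m) p p) = 0 :=
    (Filter.EventuallyEq.fderiv_eq (f := fun _ => 0) h₁).trans (by simp)
  refine Finset.sum_eq_zero fun α _ => ?_
  simp only [secondFundamentalForm, h₁.self_of_nhds, h₂]
  simp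

/-- The trace of the energy-momentum tensor with respect to the metric of `M`. -/
theorem sum_energyMomentum_frame
    [RiemannianBundle (fun x : N => TangentSpace (𝓡 n) x)] (δ₁ δ₂ : ℝ) (φ : M → N) (p : M) :
    ∑ α, energyMomentum m n δ₁ δ₂ φ p (frame m p α) (frame m p α) =
      δ₁ * (1 - m / 2) * normSqDifferential m n φ p
        + δ₂ * (m / 2 * ‖tensionField m n φ p‖ ^ 2
          + (m - 2) * innerDifferentialNablaTension m n φ p) := by
  have hα (α : Fin m) : energyMomentum m n δ₁ δ₂ φ p (frame m p α) (frame m p α) =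
      δ₁ * ‖differential m n φ p (frame m p α)‖ ^ 2
        - 2 * δ₂ * inner ℝ (differential m n φ p (frame m p α))
            (nablaTension m n φ p (frame m p α))
        + (δ₂ * (1 / 2 * ‖tensionField m n φ p‖ ^ 2 + innerDifferentialNablaTension m n φ p)
          - δ₁ * (1 / 2 * normSqDifferential m n φ p)) := by
    simp only [energyMomentum, real_inner_self_eq_norm_sq, (frame m p).norm_eq_one]
    ring
  simp only [hα, Finset.sum_add_distrib, Finset.sum_sub_distrib, ← Finset.mul_sum,
    Finset.sum_const, Finset.card_univ, Fintype.card_fin, nsmul_eq_mul]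
  rw [← normSqDifferential, ← innerDifferentialNablaTension]
  ring

theorem energyMomentum_self_of_differential_eq_zero
    [RiemannianBundle (fun x : N => TangentSpace (𝓡 n) x)] (δ₁ δ₂ : ℝ) {φ : M → N} {p : M}
    {X : TangentSpace (𝓡 m) p} (hX : differential m n φ p X = 0) :
    energyMomentum m n δ₁ δ₂ φ p X X =
      (δ₂ * (1 / 2 * ‖tensionField m n φ p‖ ^ 2 + innerDifferentialNablaTension m n φ p)
        - δ₁ * (1 / 2 * normSqDifferential m n φ p)) * ‖X‖ ^ 2 := by
  simp only [energyMomentum, hX, inner_zero_left, real_inner_self_eq_norm_sq]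
  ring

end Maps

section Kernel

variable {m n : ℕ} {M N : Type*}
  [TopologicalSpace M] [ChartedSpace (Model m) M]
  [TopologicalSpace N] [ChartedSpace (Model n) N]

theorem exists_ne_zero_differential_eq_zero {φ : M → N} {p : M}
    (h : Module.finrank ℝ (LinearMap.range (differential m n φ p).toLinearMap) < m) :
    ∃ X : TangentSpace (𝓡 m) p, X ≠ 0 ∧ differential m n φ p X = 0 := by
  have : FiniteDimensional ℝ (TangentSpace (𝓡 m) p) :=
    inferInstanceAs (FiniteDimensional ℝ (Model m))
  have hdim : Module.finrank ℝ (TangentSpace (𝓡 m) p) = m :=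
    finrank_euclideanSpace_fin (𝕜 := ℝ) (n := m)
  have hker : LinearMap.ker (differential m n φ p).toLinearMap ≠ ⊥ := fun hbot => by
    have := (differential m n φ p).toLinearMap.finrank_range_add_finrank_ker
    rw [hbot, finrank_bot, hdim] at this
    omega
  obtain ⟨X, hX, hX0⟩ := Submodule.exists_mem_ne_zero_of_ne_bot hker
  exact ⟨X, hX0, hX⟩

end Kernel

end SemiBiharmonic

theorem mainTheorem9
    {m n : ℕ} {M N : Type*}
    [TopologicalSpace M] [ChartedSpace (SemiBiharmonic.Model m) M] [IsManifold (𝓡 m) ∞ M]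
    [RiemannianBundle (fun x : M => TangentSpace (𝓡 m) x)]
    [IsContMDiffRiemannianBundle (𝓡 m) ∞ (SemiBiharmonic.Model m)
      (fun x : M => TangentSpace (𝓡 m) x)]
    [TopologicalSpace N] [ChartedSpace (SemiBiharmonic.Model n) N] [IsManifold (𝓡 n) ∞ N]
    [RiemannianBundle (fun x : N => TangentSpace (𝓡 n) x)]
    [IsContMDiffRiemannianBundle (𝓡 n) ∞ (SemiBiharmonic.Model n)
      (fun x : N => TangentSpace (𝓡 n) x)]
    (δ₁ δ₂ : ℝ) (hδ : δ₁ ≠ 0 ∨ δ₂ ≠ 0)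
    (φ : M → N) (hφ : ContMDiff (𝓡 m) (𝓡 n) ∞ φ)
    (hm : 2 < m)
    (hrank : ∀ p : M,
      Module.finrank ℝ (LinearMap.range
        (SemiBiharmonic.differential m n φ p).toLinearMap) ≤ m - 1)
    (hT : ∀ (p : M) (X Y : TangentSpace (𝓡 m) p),
      SemiBiharmonic.energyMomentum m n δ₁ δ₂ φ p X Y = 0) :
    SemiBiharmonic.IsHarmonic m n φ := by
  rcases eq_or_ne δ₂ 0 with rfl | hδ₂
  · have hδ₁ : δ₁ ≠ 0 := hδ.resolve_right fun h => h rfl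
    refine SemiBiharmonic.isHarmonic_of_differential_eq_zero hφ fun p =>
      SemiBiharmonic.differential_eq_zero_of_normSqDifferential_eq_zero ?_
    have htr := SemiBiharmonic.sum_energyMomentum_frame (m := m) (n := n) δ₁ 0 φ p
    simp only [hT, Finset.sum_const_zero, zero_mul, add_zero] at htr
    have hm' : (1 : ℝ) - m / 2 ≠ 0 := by
      have : (2 : ℝ) < m := by exact_mod_cast hm
      linarith
    exact (mul_eq_zero.1 htr.symm).resolve_left (mul_ne_zero hδ₁ hm')
  · intro p
    obtain ⟨X, hX0, hX⟩ := SemiBiharmonic.exists_ne_zero_differential_eq_zero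
      (lt_of_le_of_lt (hrank p) (by omega))
    have hXX := SemiBiharmonic.energyMomentum_self_of_differential_eq_zero δ₁ δ₂ hX
    have htr := SemiBiharmonic.sum_energyMomentum_frame (m := m) (n := n) δ₁ δ₂ φ p
    simp only [hT, Finset.sum_const_zero] at htr
    rw [hT] at hXX
    have hX' := (mul_eq_zero.1 hXX.symm).resolve_right (pow_ne_zero 2 (norm_ne_zero_iff.2 hX0))
    -- The trace minus `m - 2` times the kernel identity: the terms in `|dφ|²` and `⟨dφ, ∇τ⟩` cancel.
    have hτ : δ₂ * ‖SemiBiharmonic.tensionField m n φ p‖ ^ 2 = 0 := by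
      linear_combination (-1 : ℝ) * htr - ((m : ℝ) - 2) * hX'
    simpa [hδ₂] using hτ
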